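/- Let $\Omega_n=\{0,1\}^n$ carry the coordinatewise order and the uniform probability measure $\mu$; write $\mathbb E$ for the expectation with respect to $\mu$, and $x\oplus e_k$ for $x$ with its $k$-th coordinate flipped. A family $\mathcal A\subset\Omega_n$ is *increasing* if $x\in\mathcal A$ and $x\le y$ imply $y\in\mathcal A$. For $\mathcal A,\mathcal B\subset\Omega_n$ put $$\mathrm{Cov}(\mathcal A,\mathcal B)=\mu(\mathcal A\cap\mathcal B)-\mu(\mathcal A)\mu(\mathcal B),\quad I_k(\mathcal A)=2\mu(\{x\in\mathcal A: x\oplus e_k\notin\mathcal A\}),\quad I(\mathcal A)=\sum_{k=1}^n I_k(\mathcal A),\quad W_1(\mathcal A,\mathcal B)=\sum_{i=1}^n I_i(\mathcal A)I_i(\mathcal B).$$ For $f,g:\Omega_n\to[-1,1]$ put $$\mathrm{Cov}(f,g)=\mathbb E[fg]-\mathbb E[f]\,\mathbb E[g],\quad I_k(f)=\mathbb E\,|f(x)-f(x\oplus e_k)|,\quad I(f)=\sum_{k=1}^n I_k(f),\quad W_1(f,g)=\sum_{i=1}^n\hat f(\{i\})\,\hat g(\{i\}),$$ where $\hat f(\{i\})=\mathbb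 E[f(x)(-1)^{x_i}]$ is the level-one Fourier–Walsh coefficient (so $W_1(f,g)=\frac14\sum_i I_i(f)I_i(g)$ if $f,g$ are increasing). Let $F,G$ be two increasing families, or two increasing functions into $[-1,1]$. They are *similar* if all ratios $I_i(F)/I_i(G)$ are equal, that is, $I_i(F)I_j(G)=I_j(F)I_i(G)$ for all $i,j$. They are *weakly similar with constant* $c'>0$ if $\max_i I_i(F)/I_i(G)\le c'\min_i I_i(F)/I_i(G)$, that is, $I_i(F)I_j(G)\le c'\,I_j(F)I_i(G)$ for all $i,j$. A family or function is *regular* if all its influences $I_i$ are equal. In the bounds below the right-hand side is read as $0$ if the numerator is $0$ (in particular if all influences of $F$ or all influences of $G$ vanish). **Theorem.** There is a universal constant $c>0$ such that the following hold for every $n$. 1. If $\mathcal A,\mathcal B\subset\Omega_n$ are increasing and similar, then $$\mathrm{Cov}(\mathcal A,\mathcal B)\ \ge\ c\,\frac{W_1(\mathcal A,\mathcal B)}{\sqrt{\log\frac{e}{W_1(\mathcal A,\mathcal A)}}\,\sqrt{\log\frac{e}{W_1(\mathcal B,\mathcal B)}}}.$$ 2. In particular, if $\mathcal A,\mathcal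 B\subset\Omega_n$ are increasing and regular, then $$\mathrm{Cov}(\mathcal A,\mathcal B)\ \ge\ c\sum_{i=1}^n\frac{I_i(\mathcal A)}{\sqrt{\log\frac{e}{nI_i(\mathcal A)^2}}}\cdot\frac{I_i(\mathcal B)}{\sqrt{\log\frac{e}{nI_i(\mathcal B)^2}}}\ =\ c\,\frac{I(\mathcal A)I(\mathcal B)}{n\sqrt{\log\frac{en}{I(\mathcal A)^2}}\,\sqrt{\log\frac{en}{I(\mathcal B)^2}}}.$$ 3. If $f,g:\Omega_n\to[-1,1]$ are increasing and similar, then $$\mathrm{Cov}(f,g)\ \ge\ c\,\frac{W_1(f,g)}{\sqrt{\log\frac{e}{W_1(f,f)}}\,\sqrt{\log\frac{e}{W_1(g,g)}}};$$ if $f,g:\Omega_n\to[-1,1]$ are increasing and regular, then $$\mathrm{Cov}(f,g)\ \ge\ c\,\frac{I(f)I(g)}{n\sqrt{\log\frac{4en}{I(f)^2}}\,\sqrt{\log\frac{4en}{I(g)^2}}}.$$ Moreover, for every $c'>0$ there is a constant $c>0$ depending only on $c'$ such that, for every $n$, the inequality in 1 holds for all increasing families $\mathcal A,\mathcal B\subset\Omega_n$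 that are weakly similar with constant $c'$, and the first inequality in 3 holds for all increasing $f,g:\Omega_n\to[-1,1]$ that are weakly similar with constant $c'$. -/

import Mathlib

namespace CubeCorrelation

/-- The discrete cube `{0,1}^n`, with its coordinatewise order. -/
abbrev Cube (n : ℕ) : Type := Fin n → Bool

/-- `x ⊕ e_k`: the point `x` with its `k`-th coordinate flipped. -/
def flipAt {n : ℕ} (k : Fin n) (x : Cube n) : Cube n := Function.update x k (!(x k))

/-! ### Families of subsets -/

/-- The uniform probability measure `μ` on the cube. -/
noncomputable def mu {n : ℕ} (A : Set (Cube n)) : ℝ := (A.ncard : ℝ) / 2 ^ n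

/-- `Cov(A,B) = μ(A ∩ B) - μ(A) μ(B)`. -/
noncomputable def famCov {n : ℕ} (A B : Set (Cube n)) : ℝ := mu (A ∩ B) - mu A * mu B

/-- `I_k(A) = 2 μ({x ∈ A | x ⊕ e_k ∉ A})`. -/
noncomputable def famInfluence {n : ℕ} (A : Set (Cube n)) (k : Fin n) : ℝ :=
  2 * mu {x | x ∈ A ∧ flipAt k x ∉ A}

/-- `I(A) = ∑_k I_k(A)`. -/
noncomputable def famTotalInfluence {n : ℕ} (A : Set (Cube n)) : ℝ := ∑ k, famInfluence A k

/-- `W_1(A,B) = ∑_i I_i(A) I_i(B)`. -/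
noncomputable def famW1 {n : ℕ} (A B : Set (Cube n)) : ℝ :=
  ∑ i, famInfluence A i * famInfluence B i

/-! ### Real functions -/

/-- Expectation with respect to the uniform measure. -/
noncomputable def expect {n : ℕ} (f : Cube n → ℝ) : ℝ := (∑ x, f x) / 2 ^ n

/-- `Cov(f,g) = E[fg] - E[f] E[g]`. -/
noncomputable def funCov {n : ℕ} (f g : Cube n → ℝ) : ℝ :=
  expect (fun x => f x * g x) - expect f * expect g

/-- `I_k(f) = E[|f(x) - f(x ⊕ e_k)|]`. -/
noncomputable def funInfluence {n : ℕ} (f : Cube n → ℝ) (k : Fin n) : ℝ :=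
  expect (fun x => |f x - f (flipAt k x)|)

/-- `I(f) = ∑_k I_k(f)`. -/
noncomputable def funTotalInfluence {n : ℕ} (f : Cube n → ℝ) : ℝ := ∑ k, funInfluence f k

/-- The Walsh function `u_S(T) = (-1)^{|S ∩ T|}`, where `T = {i | x i = 1}`. -/
def walsh {n : ℕ} (S : Finset (Fin n)) (x : Cube n) : ℝ :=
  (-1) ^ (S.filter (fun i => x i = true)).card

/-- The Fourier-Walsh coefficient `⟨f, u_S⟩`. -/
noncomputable def fourierCoeff {n : ℕ} (f : Cube n → ℝ) (S : Finset (Fin n)) : ℝ :=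
  expect (fun x => f x * walsh S x)

/-- `W_d(f,g)`, the sum over all `|S| = d` of the products of the Fourier-Walsh coefficients
of `f` and `g` at `S`. -/
noncomputable def funW {n : ℕ} (d : ℕ) (f g : Cube n → ℝ) : ℝ :=
  ∑ S ∈ Finset.powersetCard d Finset.univ, fourierCoeff f S * fourierCoeff g S

/-! ### Similarity and regularity, in terms of the vectors of influences -/

/-- All ratios `a i / b i` are equal. The condition is cross-multiplied, so that a coordinate with
`a i = b i = 0` is no restriction, while a ratio `a i / 0` with `a i ≠ 0` counts as infinite. -/
def EqualRatios {n : ℕ} (a b : Fin n → ℝ) : Prop :=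
  ∀ i j, a i * b j = a j * b i

/-- `max (a i / b i) ≤ K * min (a i / b i)`, for nonnegative `a`, `b`; cross-multiplied as in
`EqualRatios`. -/
def WeaklyEqualRatios {n : ℕ} (K : ℝ) (a b : Fin n → ℝ) : Prop :=
  ∀ i j, a i * b j ≤ K * (a j * b i)

/-- `A` and `B` are similar. -/
def FamSimilar {n : ℕ} (A B : Set (Cube n)) : Prop :=
  EqualRatios (famInfluence A) (famInfluence B)

/-- `A` and `B` are weakly similar with constant `K`. -/
def FamWeaklySimilar {n : ℕ} (K : ℝ) (A B : Set (Cube n)) : Prop :=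
  WeaklyEqualRatios K (famInfluence A) (famInfluence B)

/-- `A` is regular: all its influences are equal. -/
def FamRegular {n : ℕ} (A : Set (Cube n)) : Prop :=
  ∀ i j, famInfluence A i = famInfluence A j

/-- `f` and `g` are similar. -/
def FunSimilar {n : ℕ} (f g : Cube n → ℝ) : Prop :=
  EqualRatios (funInfluence f) (funInfluence g)

/-- `f` and `g` are weakly similar with constant `K`. -/
def FunWeaklySimilar {n : ℕ} (K : ℝ) (f g : Cube n → ℝ) : Prop :=
  WeaklyEqualRatios K (funInfluence f) (funInfluence g)

/-- `f` is regular: all its influences are equal. -/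
def FunRegular {n : ℕ} (f : Cube n → ℝ) : Prop :=
  ∀ i j, funInfluence f i = funInfluence f j

/-- `f` is increasing with values in `[-1,1]`. -/
def IncreasingBounded {n : ℕ} (f : Cube n → ℝ) : Prop :=
  Monotone f ∧ ∀ x, f x ∈ Set.Icc (-1 : ℝ) 1

/-! ### The right-hand side -/

/-- `w / (√log(e/u) √log(e/v))`. It is used with `w = W_1(A,B)`, `u = W_1(A,A)` and `v = W_1(B,B)`,
where `u, v ∈ [0,1]`, so that the logarithms are at least `1` unless `u` or `v` is `0`; in that
case `w = 0` and the quotient is `0`. -/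
noncomputable def corrBound (w u v : ℝ) : ℝ :=
  w / (√(Real.log (Real.exp 1 / u)) * √(Real.log (Real.exp 1 / v)))

end CubeCorrelation

open CubeCorrelation

/-! Let `T_ρ` be the noise operator and `D_i f` half the increment of `f` in direction `i`.
Differentiating `E[T_ρ f · g]` in `ρ` gives `∑ E[T_ρ D_i f · D_i g]`, and `Cov(f,g)` is the integral
of this over `[0,1]`. For increasing functions the integrand is nonnegative, so the integral may be
cut off at any `R ≤ 1` (`noiseCorr_sub_le_funCov`).

At `ρ = 0` the integrand is `W_1(f,g)`. It stays above `W_1(f,g)/2` up to an `R` of order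
`1/(√log(e/W_1(f,f)) √log(e/W_1(g,g)))`, for the following reason. The deviation from `W_1(f,g)`
involves only nonconstant Fourier modes of the gradients. By Cauchy–Schwarz (`funW_one_sub_le`) it
is at most `η` times the geometric mean of the gradient variances of `f` and `g` after noise with
squared parameters `s` and `t`, as long as `ρ ≤ η√(st)`. If `s` is of order `1/log(e/W_1(f,f))`, the
variance for `f` is `O(W_1(f,f))` (`exists_noise_strength`), and likewise for `g`. Similarity
reverses Cauchy–Schwarz, `W_1(f,f) W_1(g,g) ≤ K W_1(f,g)²`, so a small `η` depending on `K` makes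
the deviation at most `W_1(f,g)/2`.

The variance bound combines hypercontractivity (`expect_noise_pow_le`), used for nonnegative
functions in `noiseVar_le`, with the pointwise bound `∑ (T_σ D_i f)² ≤ 1/(1-σ²)`, which is Bessel's
inequality for a biased product measure (`sum_noise_derivAt_sq_le`). Families are handled through
their `±1` indicators. -/

namespace CubeCorrelation

open Finset

/-! ### Expectation and Walsh functions -/

/-- `(-1)^b`. -/
def sgn (b : Bool) : ℝ := if b then -1 else 1

@[simp] lemma sgn_true : sgn true = -1 := rfl
@[simp] lemma sgn_false : sgn false = 1 := rfl

lemma sgn_not (b : Bool) : sgn (!b) = -sgn b := by cases b <;> simp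

lemma sgn_mul_self (b : Bool) : sgn b * sgn b = 1 := by cases b <;> simp

lemma walsh_eq_prod {n : ℕ} (S : Finset (Fin n)) (x : Cube n) :
    walsh S x = ∏ i ∈ S, sgn (x i) := by
  simp [walsh, sgn, Finset.prod_ite]

@[simp] lemma walsh_empty {n : ℕ} (x : Cube n) : walsh ∅ x = 1 := by simp [walsh]

lemma expect_add {n : ℕ} (f g : Cube n → ℝ) :
    expect (fun x => f x + g x) = expect f + expect g := by
  simp [expect, sum_add_distrib, add_div]

lemma expect_sub {n : ℕ} (f g : Cube n → ℝ) :
    expect (fun x => f x - g x) = expect f - expect g := by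
  simp [expect, sum_sub_distrib, sub_div]

lemma expect_const_mul {n : ℕ} (c : ℝ) (f : Cube n → ℝ) :
    expect (fun x => c * f x) = c * expect f := by
  simp [expect, ← mul_sum, mul_div_assoc]

lemma expect_sum {n : ℕ} {ι : Type*} (s : Finset ι) (f : ι → Cube n → ℝ) :
    expect (fun x => ∑ i ∈ s, f i x) = ∑ i ∈ s, expect (f i) := by
  simp only [expect]
  rw [sum_comm, sum_div]

@[simp] lemma expect_const {n : ℕ} (c : ℝ) : expect (fun _ : Cube n => c) = c := by
  simp [expect]

lemma expect_mono {n : ℕ} {f g : Cube n → ℝ} (h : ∀ x, f x ≤ g x) : expect f ≤ expect g := by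
  unfold expect
  gcongr with x
  exact h x

lemma expect_nonneg {n : ℕ} {f : Cube n → ℝ} (h : ∀ x, 0 ≤ f x) : 0 ≤ expect f :=
  div_nonneg (sum_nonneg fun x _ => h x) (by positivity)

lemma expect_prod {n : ℕ} (φ : Fin n → Bool → ℝ) :
    expect (fun x => ∏ i, φ i (x i)) = ∏ i, (φ i true + φ i false) / 2 := by
  have h := Finset.prod_univ_sum (fun _ : Fin n => (univ : Finset Bool)) φ
  rw [Fintype.piFinset_univ] at h
  rw [expect, ← h, prod_div_distrib]
  simp

lemma flipAt_flipAt {n : ℕ} (k : Fin n) (x : Cube n) : flipAt k (flipAt k x) = x := by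
  ext i
  by_cases h : i = k
  · subst h; simp [flipAt]
  · simp [flipAt, h]

lemma flipAt_same {n : ℕ} (k : Fin n) (x : Cube n) : flipAt k x k = !(x k) := by
  simp [flipAt]

lemma flipAt_of_ne {n : ℕ} {i k : Fin n} (h : i ≠ k) (x : Cube n) : flipAt k x i = x i := by
  simp [flipAt, h]

lemma expect_flipAt {n : ℕ} (k : Fin n) (f : Cube n → ℝ) :
    expect (fun x => f (flipAt k x)) = expect f := by
  unfold expect
  congr 1
  exact Equiv.sum_comp (Function.Involutive.toPerm (flipAt k) (flipAt_flipAt k)) f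

lemma expect_walsh_mul_walsh {n : ℕ} (S U : Finset (Fin n)) :
    expect (fun x => walsh S x * walsh U x) = if S = U then 1 else 0 := by
  have h : ∀ x : Cube n, walsh S x * walsh U x =
      ∏ i, ((if i ∈ S then sgn (x i) else 1) * (if i ∈ U then sgn (x i) else 1)) := by
    intro x
    rw [prod_mul_distrib, walsh_eq_prod, walsh_eq_prod]
    simp only [prod_ite_mem, univ_inter]
  simp_rw [h]
  rw [expect_prod (fun i b => (if i ∈ S then sgn b else 1) * (if i ∈ U then sgn b else 1))]
  split_ifs with hSU
  · subst hSU
    refine prod_eq_one fun i _ => ?_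
    split_ifs <;> norm_num
  · obtain ⟨i, hi⟩ : ∃ i, ¬ (i ∈ S ↔ i ∈ U) := by
      by_contra! hc
      exact hSU (Finset.ext hc)
    refine prod_eq_zero (mem_univ i) ?_
    by_cases h1 : i ∈ S <;> by_cases h2 : i ∈ U <;> simp_all

/-! ### The noise operator -/

/-- The kernel of the noise operator. -/
def noiseKernel {n : ℕ} (ρ : ℝ) (x y : Cube n) : ℝ := ∏ i, (1 + ρ * (sgn (x i) * sgn (y i)))

/-- The noise operator `T_ρ`. -/
noncomputable def noise {n : ℕ} (ρ : ℝ) (f : Cube n → ℝ) (x : Cube n) : ℝ :=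
  expect (fun y => f y * noiseKernel ρ x y)

lemma noiseKernel_nonneg {n : ℕ} {ρ : ℝ} (h0 : 0 ≤ ρ) (h1 : ρ ≤ 1) (x y : Cube n) :
    0 ≤ noiseKernel ρ x y := by
  refine prod_nonneg fun i _ => ?_
  cases x i <;> cases y i <;> simp <;> linarith

lemma noise_nonneg {n : ℕ} {ρ : ℝ} (h0 : 0 ≤ ρ) (h1 : ρ ≤ 1) {f : Cube n → ℝ}
    (hf : ∀ x, 0 ≤ f x) (x : Cube n) : 0 ≤ noise ρ f x :=
  expect_nonneg fun y => mul_nonneg (hf y) (noiseKernel_nonneg h0 h1 x y)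

lemma noiseKernel_eq_sum {n : ℕ} (ρ : ℝ) (x y : Cube n) :
    noiseKernel ρ x y = ∑ S : Finset (Fin n), ρ ^ S.card * walsh S x * walsh S y := by
  rw [noiseKernel, Finset.prod_one_add, powerset_univ]
  refine sum_congr rfl fun S _ => ?_
  rw [prod_mul_distrib, prod_mul_distrib, prod_const, walsh_eq_prod, walsh_eq_prod, mul_assoc]

lemma noise_eq_sum {n : ℕ} (ρ : ℝ) (f : Cube n → ℝ) (x : Cube n) :
    noise ρ f x = ∑ S : Finset (Fin n), ρ ^ S.card * fourierCoeff f S * walsh S x := by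
  simp only [noise, noiseKernel_eq_sum, mul_sum, expect_sum]
  refine sum_congr rfl fun S _ => ?_
  rw [fourierCoeff, mul_right_comm, ← expect_const_mul]
  congr 1
  ext y
  ring

lemma noise_one {n : ℕ} (f : Cube n → ℝ) (x : Cube n) : noise 1 f x = f x := by
  rw [noise, expect, sum_eq_single x]
  · have : noiseKernel 1 x x = 2 ^ n := by
      simp [noiseKernel, sgn_mul_self]
      norm_num
    rw [this]
    field_simp
  · intro y _ hy
    obtain ⟨i, hi⟩ := Function.ne_iff.mp hy
    rw [noiseKernel, prod_eq_zero (mem_univ i), mul_zero]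
    revert hi
    cases x i <;> cases y i <;> simp
  · simp

lemma fourierCoeff_noise {n : ℕ} (ρ : ℝ) (f : Cube n → ℝ) (S : Finset (Fin n)) :
    fourierCoeff (noise ρ f) S = ρ ^ S.card * fourierCoeff f S := by
  rw [fourierCoeff]
  simp only [noise_eq_sum, sum_mul, expect_sum, mul_assoc, expect_const_mul,
    expect_walsh_mul_walsh]
  simp

lemma expect_noise_mul {n : ℕ} (ρ : ℝ) (f g : Cube n → ℝ) :
    expect (fun x => noise ρ f x * g x) =
      ∑ S : Finset (Fin n), ρ ^ S.card * (fourierCoeff f S * fourierCoeff g S) := by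
  simp only [noise_eq_sum, sum_mul, expect_sum]
  refine sum_congr rfl fun S _ => ?_
  rw [fourierCoeff.eq_1 g, ← mul_assoc, ← expect_const_mul]
  congr 1
  ext x
  ring

lemma expect_mul_eq_sum {n : ℕ} (f g : Cube n → ℝ) :
    expect (fun x => f x * g x) =
      ∑ S : Finset (Fin n), fourierCoeff f S * fourierCoeff g S := by
  simpa [noise_one] using expect_noise_mul 1 f g

lemma fourierCoeff_empty {n : ℕ} (f : Cube n → ℝ) : fourierCoeff f ∅ = expect f := by
  simp [fourierCoeff]

lemma fourierCoeff_const {n : ℕ} (c : ℝ) {S : Finset (Fin n)} (hS : S ≠ ∅) :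
    fourierCoeff (fun _ : Cube n => c) S = 0 := by
  have := expect_walsh_mul_walsh (∅ : Finset (Fin n)) S
  rw [if_neg (Ne.symm hS)] at this
  simp only [walsh_empty, one_mul] at this
  rw [fourierCoeff, expect_const_mul, this, mul_zero]

lemma fourierCoeff_sub {n : ℕ} (f g : Cube n → ℝ) (S : Finset (Fin n)) :
    fourierCoeff (fun x => f x - g x) S = fourierCoeff f S - fourierCoeff g S := by
  simp only [fourierCoeff, sub_mul, expect_sub]

lemma expect_noise {n : ℕ} (ρ : ℝ) (f : Cube n → ℝ) : expect (noise ρ f) = expect f := by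
  rw [← fourierCoeff_empty, fourierCoeff_noise]
  simp [fourierCoeff_empty]

lemma noise_const {n : ℕ} (ρ c : ℝ) (x : Cube n) : noise ρ (fun _ => c) x = c := by
  rw [noise_eq_sum, sum_eq_single ∅]
  · simp [fourierCoeff_empty]
  · intro S _ hS
    simp [fourierCoeff_const c hS]
  · simp

/-! ### Discrete derivatives -/

/-- Half the increment of `f` in the direction of the `i`-th coordinate. -/
noncomputable def derivAt {n : ℕ} (i : Fin n) (f : Cube n → ℝ) (x : Cube n) : ℝ :=
  -(sgn (x i) * (f x - f (flipAt i x)) / 2)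

lemma derivAt_flipAt {n : ℕ} (i : Fin n) (f : Cube n → ℝ) (x : Cube n) :
    derivAt i f (flipAt i x) = derivAt i f x := by
  simp only [derivAt, flipAt_flipAt, flipAt_same, sgn_not]
  ring

lemma derivAt_nonneg {n : ℕ} {f : Cube n → ℝ} (hf : Monotone f) (i : Fin n) (x : Cube n) :
    0 ≤ derivAt i f x := by
  unfold derivAt
  cases h : x i
  · have : f x ≤ f (flipAt i x) := hf fun j => by
      by_cases hj : j = i
      · subst hj; simp [h]
      · rw [flipAt_of_ne hj]
    simp
    linarith
  · have : f (flipAt i x) ≤ f x := hf fun j => by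
      by_cases hj : j = i
      · subst hj; simp [flipAt_same, h]
      · rw [flipAt_of_ne hj]
    simp
    linarith

lemma abs_derivAt {n : ℕ} (i : Fin n) (f : Cube n → ℝ) (x : Cube n) :
    |derivAt i f x| = |f x - f (flipAt i x)| / 2 := by
  have : |sgn (x i)| = 1 := by cases x i <;> simp
  simp [derivAt, abs_mul, abs_div, this]

lemma walsh_flipAt_of_notMem {n : ℕ} {i : Fin n} {S : Finset (Fin n)} (h : i ∉ S) (x : Cube n) :
    walsh S (flipAt i x) = walsh S x := by
  rw [walsh_eq_prod, walsh_eq_prod]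
  refine prod_congr rfl fun j hj => ?_
  rw [flipAt_of_ne]
  rintro rfl
  exact h hj

lemma walsh_insert {n : ℕ} {i : Fin n} {S : Finset (Fin n)} (h : i ∉ S) (x : Cube n) :
    walsh (insert i S) x = sgn (x i) * walsh S x := by
  rw [walsh_eq_prod, walsh_eq_prod, prod_insert h]

/-- Discrete integration by parts: flipping coordinate `i` preserves the measure and changes the
sign of `sgn (x i)`. The minus sign is there because `sgn true = -1`. -/
lemma expect_derivAt_mul {n : ℕ} (i : Fin n) (f g : Cube n → ℝ)
    (hg : ∀ x, g (flipAt i x) = g x) :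
    expect (fun x => derivAt i f x * g x) = -expect (fun x => f x * (sgn (x i) * g x)) := by
  have h := expect_flipAt i (fun x => f x * (sgn (x i) * g x))
  simp only [flipAt_same, sgn_not, hg] at h
  have h2 : (fun x => derivAt i f x * g x) = fun x =>
      (-1 / 2) * (f x * (sgn (x i) * g x)) +
        (-1 / 2) * (f (flipAt i x) * (-sgn (x i) * g x)) := by
    ext x
    simp only [derivAt]
    ring
  rw [h2, expect_add, expect_const_mul, expect_const_mul, h]
  ring

lemma fourierCoeff_derivAt_of_notMem {n : ℕ} {i : Fin n} {S : Finset (Fin n)} (h : i ∉ S)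
    (f : Cube n → ℝ) : fourierCoeff (derivAt i f) S = -fourierCoeff f (insert i S) := by
  simp only [fourierCoeff, walsh_insert h]
  exact expect_derivAt_mul i f _ (walsh_flipAt_of_notMem h)

lemma expect_mul_sgn_eq_zero {n : ℕ} (i : Fin n) (g : Cube n → ℝ)
    (hg : ∀ x, g (flipAt i x) = g x) : expect (fun x => g x * sgn (x i)) = 0 := by
  have h := expect_flipAt i (fun x => g x * sgn (x i))
  simp only [flipAt_same, sgn_not, hg, mul_neg] at h
  have h2 := expect_const_mul (-1) (fun x : Cube n => g x * sgn (x i))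
  simp only [neg_mul, one_mul] at h2
  linarith

lemma fourierCoeff_derivAt_of_mem {n : ℕ} {i : Fin n} {S : Finset (Fin n)} (h : i ∈ S)
    (f : Cube n → ℝ) : fourierCoeff (derivAt i f) S = 0 := by
  have h1 : ∀ x : Cube n, derivAt i f x * walsh S x =
      derivAt i f x * walsh (S.erase i) x * sgn (x i) := by
    intro x
    conv_lhs => rw [← insert_erase h, walsh_insert (notMem_erase i S)]
    ring
  simp only [fourierCoeff, h1]
  refine expect_mul_sgn_eq_zero i _ fun x => ?_
  rw [derivAt_flipAt, walsh_flipAt_of_notMem (notMem_erase i S)]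

lemma expect_derivAt {n : ℕ} (i : Fin n) (f : Cube n → ℝ) :
    expect (derivAt i f) = -fourierCoeff f {i} := by
  rw [← fourierCoeff_empty, fourierCoeff_derivAt_of_notMem (notMem_empty i)]
  simp

lemma funInfluence_eq {n : ℕ} {f : Cube n → ℝ} (hf : Monotone f) (i : Fin n) :
    funInfluence f i = 2 * expect (derivAt i f) := by
  rw [funInfluence, ← expect_const_mul]
  congr 1
  ext x
  have := abs_derivAt i f x
  rw [abs_of_nonneg (derivAt_nonneg hf i x)] at this
  linarith

lemma funW_one_eq {n : ℕ} (f g : Cube n → ℝ) :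
    funW 1 f g = ∑ i, expect (derivAt i f) * expect (derivAt i g) := by
  simp [funW, powersetCard_one, expect_derivAt]

/-! ### Hypercontractivity for even exponents -/

/-- Termwise comparison of binomial coefficients behind the two-point inequality. From `k` to `k +
1` the left side grows by `(m-k)(2m-2k-1)/((k+1)(2k+1))`, the right side by `(2m-1)(m-k)/(k+1)`,
which is at least as large. -/
lemma choose_two_mul_le (m k : ℕ) :
    (2 * m).choose (2 * k) ≤ (2 * m - 1) ^ k * m.choose k := by
  induction k with
  | zero => simp
  | succ k ih =>
    rcases lt_or_ge k m with hk | hk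
    · obtain ⟨j, rfl⟩ : ∃ j, m = k + 1 + j := ⟨m - (k + 1), by omega⟩
      have h1 := Nat.choose_succ_right_eq (2 * (k + 1 + j)) (2 * k)
      have h2 := Nat.choose_succ_right_eq (2 * (k + 1 + j)) (2 * k + 1)
      have h3 := Nat.choose_succ_right_eq (k + 1 + j) k
      rw [show 2 * (k + 1 + j) - 2 * k = 2 * (j + 1) by omega] at h1
      rw [show 2 * (k + 1 + j) - (2 * k + 1) = 2 * j + 1 by omega] at h2
      rw [show k + 1 + j - k = j + 1 by omega] at h3
      rw [show 2 * (k + 1 + j) - 1 = 2 * k + 2 * j + 1 by omega] at ih ⊢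
      rw [show 2 * (k + 1) = 2 * k + 1 + 1 by omega]
      set a := (2 * (k + 1 + j)).choose (2 * k)
      set b := (2 * (k + 1 + j)).choose (2 * k + 1)
      set c := (2 * (k + 1 + j)).choose (2 * k + 1 + 1)
      set d := (k + 1 + j).choose k
      set e := (k + 1 + j).choose (k + 1)
      refine Nat.le_of_mul_le_mul_right (c := (2 * k + 1 + 1) * (2 * k + 1)) ?_ (by positivity)
      calc c * ((2 * k + 1 + 1) * (2 * k + 1)) = c * (2 * k + 1 + 1) * (2 * k + 1) := by ring
        _ = b * (2 * k + 1) * (2 * j + 1) := by rw [h2]; ring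
        _ = a * (2 * (j + 1)) * (2 * j + 1) := by rw [h1]
        _ ≤ (2 * k + 2 * j + 1) ^ k * d * (2 * (j + 1)) *
              ((2 * k + 2 * j + 1) * (2 * k + 1)) := by
            gcongr
            nlinarith
        _ = (2 * k + 2 * j + 1) ^ (k + 1) * (d * (j + 1)) * (2 * (2 * k + 1)) := by ring
        _ = (2 * k + 2 * j + 1) ^ (k + 1) * e * ((2 * k + 1 + 1) * (2 * k + 1)) := by
            rw [← h3]; ring
    · rw [Nat.choose_eq_zero_of_lt (by omega)]
      exact Nat.zero_le _

lemma sum_range_even_odd (F : ℕ → ℝ) (m : ℕ) :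
    ∑ i ∈ range (2 * m + 1), F i =
      ∑ k ∈ range (m + 1), F (2 * k) + ∑ k ∈ range m, F (2 * k + 1) := by
  induction m with
  | zero => simp
  | succ m ih =>
    rw [show 2 * (m + 1) + 1 = 2 * m + 1 + 1 + 1 by ring, sum_range_succ, sum_range_succ, ih,
      sum_range_succ (fun k => F (2 * k)) (m + 1), sum_range_succ (fun k => F (2 * k + 1)) m,
      show 2 * (m + 1) = 2 * m + 1 + 1 by ring]
    ring

lemma add_pow_add_sub_pow (a b : ℝ) (m : ℕ) :
    ((a + b) ^ (2 * m) + (a - b) ^ (2 * m)) / 2 =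
      ∑ k ∈ range (m + 1), (b ^ 2) ^ k * (a ^ 2) ^ (m - k) * ((2 * m).choose (2 * k) : ℝ) := by
  have h1 := add_pow b a (2 * m)
  have h2 := add_pow (-b) a (2 * m)
  rw [sum_range_even_odd] at h1 h2
  rw [add_comm a b, h1, show a - b = -b + a by ring, h2]
  have h3 : ∀ k ∈ range m, (-b) ^ (2 * k + 1) * a ^ (2 * m - (2 * k + 1)) *
      ((2 * m).choose (2 * k + 1) : ℝ) = -(b ^ (2 * k + 1) * a ^ (2 * m - (2 * k + 1)) *
      ((2 * m).choose (2 * k + 1) : ℝ)) := by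
    intro k _
    rw [Odd.neg_pow ⟨k, rfl⟩]
    ring
  have h4 : ∀ k ∈ range (m + 1), (-b) ^ (2 * k) * a ^ (2 * m - 2 * k) *
      ((2 * m).choose (2 * k) : ℝ) = (b ^ 2) ^ k * (a ^ 2) ^ (m - k) *
      ((2 * m).choose (2 * k) : ℝ) := by
    intro k _
    rw [← pow_mul, ← pow_mul, Nat.mul_sub, Even.neg_pow ⟨k, by ring⟩]
  have h5 : ∀ k ∈ range (m + 1), b ^ (2 * k) * a ^ (2 * m - 2 * k) *
      ((2 * m).choose (2 * k) : ℝ) = (b ^ 2) ^ k * (a ^ 2) ^ (m - k) *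
      ((2 * m).choose (2 * k) : ℝ) := by
    intro k _
    rw [← pow_mul, ← pow_mul, Nat.mul_sub]
  rw [sum_congr rfl h3, sum_congr rfl h4, sum_congr rfl h5, sum_neg_distrib]
  ring

/-- The two-point hypercontractive inequality. -/
lemma two_point_le {m : ℕ} {ρ : ℝ} (hm : 1 ≤ m) (hρ : ρ ^ 2 * (2 * m - 1) ≤ 1) (a b : ℝ) :
    ((a + ρ * b) ^ (2 * m) + (a - ρ * b) ^ (2 * m)) / 2 ≤ (a ^ 2 + b ^ 2) ^ m := by
  -- The odd powers of `b` cancel, and the remaining terms are compared one by one.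
  rw [add_pow_add_sub_pow, add_comm (a ^ 2), add_pow]
  refine sum_le_sum fun k _ => ?_
  have h1 : ((2 * m).choose (2 * k) : ℝ) ≤ (2 * m - 1) ^ k * m.choose k := by
    have := choose_two_mul_le m k
    have h2 : ((2 * m - 1 : ℕ) : ℝ) = 2 * m - 1 := by
      rw [Nat.cast_sub (by omega)]
      simp
    rw [← h2]
    exact_mod_cast this
  have hm1 : (1 : ℝ) ≤ m := by exact_mod_cast hm
  have h3 : (ρ ^ 2) ^ k * ((2 * m).choose (2 * k) : ℝ) ≤ m.choose k := by
    calc (ρ ^ 2) ^ k * ((2 * m).choose (2 * k) : ℝ)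
        ≤ (ρ ^ 2) ^ k * ((2 * m - 1) ^ k * m.choose k) := by gcongr
      _ = (ρ ^ 2 * (2 * m - 1)) ^ k * m.choose k := by rw [mul_pow]; ring
      _ ≤ 1 * m.choose k := by
          gcongr
          refine pow_le_one₀ ?_ hρ
          have : (0 : ℝ) ≤ 2 * m - 1 := by linarith
          positivity
      _ = m.choose k := one_mul _
  calc ((ρ * b) ^ 2) ^ k * (a ^ 2) ^ (m - k) * ((2 * m).choose (2 * k) : ℝ)
      = (b ^ 2) ^ k * (a ^ 2) ^ (m - k) * ((ρ ^ 2) ^ k * ((2 * m).choose (2 * k) : ℝ)) := by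
        rw [mul_pow ρ b 2, mul_pow (ρ ^ 2)]; ring
    _ ≤ _ := by gcongr

lemma eq_zero_of_expect_nonpos {n : ℕ} {f : Cube n → ℝ} (hf : ∀ x, 0 ≤ f x)
    (h : expect f ≤ 0) (x : Cube n) : f x = 0 := by
  have h1 : ∑ x, f x = 0 := by
    have h2 : expect f = 0 := le_antisymm h (expect_nonneg hf)
    simpa [expect] using h2
  exact (sum_eq_zero_iff_of_nonneg fun x _ => hf x).1 h1 x (mem_univ x)

/-- Minkowski's inequality for nonnegative functions and natural exponents. -/
lemma expect_add_pow_le {n m : ℕ} (hm : 1 ≤ m) {u v : Cube n → ℝ} (hu : ∀ x, 0 ≤ u x)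
    (hv : ∀ x, 0 ≤ v x) {A B : ℝ} (hA : 0 ≤ A) (hB : 0 ≤ B)
    (hAu : expect (fun x => u x ^ m) ≤ A ^ m) (hBv : expect (fun x => v x ^ m) ≤ B ^ m) :
    expect (fun x => (u x + v x) ^ m) ≤ (A + B) ^ m := by
  have hm0 : m ≠ 0 := by omega
  rcases hA.eq_or_lt with rfl | hA
  · have h0 : ∀ x, u x = 0 := fun x => by
      rw [zero_pow hm0] at hAu
      exact eq_zero_of_pow_eq_zero
        (eq_zero_of_expect_nonpos (fun x => pow_nonneg (hu x) m) hAu x)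
    simpa [h0] using hBv
  rcases hB.eq_or_lt with rfl | hB
  · have h0 : ∀ x, v x = 0 := fun x => by
      rw [zero_pow hm0] at hBv
      exact eq_zero_of_pow_eq_zero
        (eq_zero_of_expect_nonpos (fun x => pow_nonneg (hv x) m) hBv x)
    simpa [h0] using hAu
  have hAB : 0 < A + B := by positivity
  have key : ∀ x, (u x + v x) ^ m ≤ (A + B) ^ m *
      -- Convexity of `t ^ m` at the points `u / A` and `v / B`, with weights `A / (A + B)` and `B /
      -- (A + B)`.
      (A / (A + B) / A ^ m * u x ^ m + B / (A + B) / B ^ m * v x ^ m) := by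
    intro x
    have hc := (convexOn_pow (𝕜 := ℝ) m).2 (Set.mem_Ici.2 (div_nonneg (hu x) hA.le))
      (Set.mem_Ici.2 (div_nonneg (hv x) hB.le)) (div_nonneg hA.le hAB.le)
      (div_nonneg hB.le hAB.le) (by field_simp)
    simp only [smul_eq_mul] at hc
    have e1 : A / (A + B) * (u x / A) + B / (A + B) * (v x / B) = (u x + v x) / (A + B) := by
      field_simp
    rw [e1, div_pow, div_le_iff₀ (by positivity)] at hc
    refine hc.trans (le_of_eq ?_)
    rw [div_pow, div_pow]
    ring
  calc expect (fun x => (u x + v x) ^ m)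
      ≤ (A + B) ^ m * (A / (A + B) / A ^ m * expect (fun x => u x ^ m) +
          B / (A + B) / B ^ m * expect (fun x => v x ^ m)) := by
        rw [← expect_const_mul, ← expect_const_mul, ← expect_add, ← expect_const_mul]
        exact expect_mono key
    _ ≤ (A + B) ^ m * (A / (A + B) / A ^ m * A ^ m + B / (A + B) / B ^ m * B ^ m) := by
        gcongr
    _ = (A + B) ^ m := by
        field_simp

lemma expect_succ {n : ℕ} (f : Cube (n + 1) → ℝ) :
    expect f = expect (fun y : Cube n =>
      (f (Fin.cons false y) + f (Fin.cons true y)) / 2) := by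
  have h : ∑ x, f x = ∑ y : Cube n, (f (Fin.cons false y) + f (Fin.cons true y)) := by
    rw [← Equiv.sum_comp (Fin.consEquiv fun _ : Fin (n + 1) => Bool) f,
      Fintype.sum_prod_type_right]
    refine sum_congr rfl fun y _ => ?_
    rw [Fintype.sum_bool, add_comm]
    rfl
  rw [expect, expect, h, ← sum_div, pow_succ]
  field_simp

lemma noise_cons {n : ℕ} (ρ : ℝ) (f : Cube (n + 1) → ℝ) (b : Bool) (y : Cube n) :
    noise ρ f (Fin.cons b y) =
      noise ρ (fun z => (f (Fin.cons false z) + f (Fin.cons true z)) / 2) y +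
        ρ * (sgn b * noise ρ (fun z => (f (Fin.cons false z) - f (Fin.cons true z)) / 2) y) := by
  have hk : ∀ (b' : Bool) (z : Cube n), noiseKernel ρ (Fin.cons b y : Cube (n + 1)) (Fin.cons b' z)
      = (1 + ρ * (sgn b * sgn b')) * noiseKernel ρ y z := by
    intro b' z
    simp [noiseKernel, Fin.prod_univ_succ]
  rw [noise, expect_succ]
  simp only [hk]
  rw [noise, noise, ← expect_const_mul (sgn b), ← expect_const_mul ρ, ← expect_add]
  congr 1
  ext z
  simp
  ring

/-- Bonami's hypercontractive inequality from `L²` to `L^{2m}`. -/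
theorem expect_noise_pow_le {m : ℕ} {ρ : ℝ} (hm : 1 ≤ m) (hρ : ρ ^ 2 * (2 * m - 1) ≤ 1) {n : ℕ}
    (f : Cube n → ℝ) :
    expect (fun x => noise ρ f x ^ (2 * m)) ≤ expect (fun x => f x ^ 2) ^ m := by
  induction n with
  | zero =>
    have h : ∀ x : Cube 0, noise ρ f x = f x := by
      intro x
      rw [noise, expect, Fintype.sum_unique]
      simp only [noiseKernel, univ_eq_empty, prod_empty, mul_one, pow_zero, div_one]
      exact congrArg f (Subsingleton.elim _ _)
    simp [h, expect, pow_mul]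
  | succ n ih =>
    set g : Cube n → ℝ := fun z => (f (Fin.cons false z) + f (Fin.cons true z)) / 2 with hg
    set h : Cube n → ℝ := fun z => (f (Fin.cons false z) - f (Fin.cons true z)) / 2 with hh
    rw [expect_succ, expect_succ]
    simp only [noise_cons, ← hg, ← hh]
    have h1 : (fun y : Cube n => (f (Fin.cons false y) ^ 2 + f (Fin.cons true y) ^ 2) / 2) =
        fun y => g y ^ 2 + h y ^ 2 := by
      ext y
      simp only [hg, hh]
      ring
    rw [h1, expect_add]
    -- The two-point inequality in the first coordinate bounds the integrand by the `m`-th power of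
    -- `(T g)² + (T h)²`. Minkowski in `L^m` separates the two squares, and induction bounds each of
    -- them.
    refine le_trans (expect_mono fun y => ?_) (expect_add_pow_le hm
      (u := fun y => noise ρ g y ^ 2) (v := fun y => noise ρ h y ^ 2)
      (fun y => sq_nonneg _) (fun y => sq_nonneg _) (expect_nonneg fun y => sq_nonneg _)
      (expect_nonneg fun y => sq_nonneg _) ?_ ?_)
    · have := two_point_le hm hρ (noise ρ g y) (noise ρ h y)
      simpa [sub_eq_add_neg] using this
    · simpa [← pow_mul] using ih g
    · simpa [← pow_mul] using ih h

/-! ### The gradient of the noise of a bounded function -/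

/-- Integration by parts under the product measure with density `noiseKernel ρ x`, for which `sgn (y
i)` has mean `ρ * sgn (x i)` and variance `1 - ρ ^ 2`. -/
lemma expect_mul_noiseKernel_mul {n : ℕ} (ρ : ℝ) (f : Cube n → ℝ) (i : Fin n) (x : Cube n) :
    expect (fun y => f y * (sgn (y i) - ρ * sgn (x i)) * noiseKernel ρ x y) =
      -((1 - ρ ^ 2) * noise ρ (derivAt i f) x) := by
  set K : Cube n → ℝ := fun y => ∏ j ∈ univ.erase i, (1 + ρ * (sgn (x j) * sgn (y j))) with hK
  have hKf : ∀ y, K (flipAt i y) = K y := fun y => by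
    refine prod_congr rfl fun j hj => ?_
    rw [flipAt_of_ne (ne_of_mem_erase hj)]
  have hker : ∀ y, noiseKernel ρ x y = (1 + ρ * (sgn (x i) * sgn (y i))) * K y := fun y =>
    (mul_prod_erase univ (fun j => 1 + ρ * (sgn (x j) * sgn (y j))) (mem_univ i)).symm
  have h1 : (fun y => f y * (sgn (y i) - ρ * sgn (x i)) * noiseKernel ρ x y) = fun y =>
      (1 - ρ ^ 2) * (f y * (sgn (y i) * K y)) := by
    ext y
    rw [hker]
    linear_combination (f y * K y * ρ * sgn (x i)) * sgn_mul_self (y i) -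
      (f y * K y * ρ ^ 2 * sgn (y i)) * sgn_mul_self (x i)
  have h2 : noise ρ (derivAt i f) x = expect (fun y => derivAt i f y * K y) := by
    have h3 : (fun y => derivAt i f y * noiseKernel ρ x y) = fun y =>
        derivAt i f y * K y + ρ * sgn (x i) * (derivAt i f y * K y * sgn (y i)) := by
      ext y
      rw [hker]
      ring
    rw [noise, h3, expect_add, expect_const_mul, expect_mul_sgn_eq_zero i
      (fun y => derivAt i f y * K y) (fun y => by rw [derivAt_flipAt, hKf]), mul_zero, add_zero]
  rw [h1, expect_const_mul, h2, expect_derivAt_mul i f K hKf]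
  ring

lemma derivAt_sgn_sub {n : ℕ} (i j : Fin n) (c : ℝ) (y : Cube n) :
    derivAt i (fun y => sgn (y j) - c) y = if i = j then -1 else 0 := by
  split_ifs with h
  · subst h
    simp only [derivAt, flipAt_same, sgn_not]
    linear_combination -sgn_mul_self (y i)
  · simp [derivAt, flipAt_of_ne (Ne.symm h)]

/-- Bessel's inequality for a biased product measure. -/
theorem sum_noise_derivAt_sq_le {n : ℕ} {ρ : ℝ} (h0 : 0 ≤ ρ) (h1 : ρ ≤ 1) {f : Cube n → ℝ}
    (hf : ∀ x, f x ∈ Set.Icc (-1 : ℝ) 1) (x : Cube n) :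
    (1 - ρ ^ 2) * ∑ i, noise ρ (derivAt i f) x ^ 2 ≤ 1 := by
  set c : Fin n → ℝ := fun i => noise ρ (derivAt i f) x with hc
  set v : Fin n → Cube n → ℝ := fun i y => sgn (y i) - ρ * sgn (x i) with hv
  have hfv : ∀ i, expect (fun y => f y * v i y * noiseKernel ρ x y) = -((1 - ρ ^ 2) * c i) :=
    fun i => expect_mul_noiseKernel_mul ρ f i x
  -- The centred coordinates are orthogonal: integration by parts again, now with `v j`, whose
  -- derivative is constant.
  have hvv : ∀ i j, expect (fun y => v j y * v i y * noiseKernel ρ x y) =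
      if i = j then 1 - ρ ^ 2 else 0 := by
    intro i j
    rw [expect_mul_noiseKernel_mul ρ (v j) i x]
    have : derivAt i (v j) = fun _ => if i = j then -1 else 0 :=
      funext fun y => derivAt_sgn_sub i j _ y
    rw [this, noise_const]
    split_ifs <;> ring
  have hff : expect (fun y => f y ^ 2 * noiseKernel ρ x y) ≤ 1 := by
    calc expect (fun y => f y ^ 2 * noiseKernel ρ x y)
        ≤ expect (fun y => 1 * noiseKernel ρ x y) := expect_mono fun y => by
          have := hf y
          gcongr
          · exact noiseKernel_nonneg h0 h1 x y
          · rw [sq_le_one_iff_abs_le_one, abs_le]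
            exact this
      _ = 1 := noise_const ρ 1 x
  have hexp : expect (fun y => (f y + ∑ i, c i * v i y) ^ 2 * noiseKernel ρ x y) =
      expect (fun y => f y ^ 2 * noiseKernel ρ x y) +
        2 * ∑ i, c i * expect (fun y => f y * v i y * noiseKernel ρ x y) +
        ∑ i, ∑ j, c i * c j * expect (fun y => v j y * v i y * noiseKernel ρ x y) := by
    simp only [← expect_const_mul, ← expect_sum, ← expect_add]
    congr 1
    ext y
    have e1 : ∑ i, c i * (f y * v i y * noiseKernel ρ x y) =
        f y * noiseKernel ρ x y * ∑ i, c i * v i y := by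
      rw [mul_sum]
      exact sum_congr rfl fun i _ => by ring
    have e2 : ∑ i, ∑ j, c i * c j * (v j y * v i y * noiseKernel ρ x y) =
        (∑ i, c i * v i y) * (∑ j, c j * v j y) * noiseKernel ρ x y := by
      rw [sum_mul_sum, sum_mul]
      refine sum_congr rfl fun i _ => ?_
      rw [sum_mul]
      exact sum_congr rfl fun j _ => by ring
    rw [e1, e2]
    ring
  -- Since `f` has inner product `-(1 - ρ²) c i` with `v i`, the vector `-∑ c i v i` is its
  -- projection onto the span of the `v i`.
  have hnn : 0 ≤ expect (fun y => (f y + ∑ i, c i * v i y) ^ 2 * noiseKernel ρ x y) :=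
    expect_nonneg fun y => mul_nonneg (sq_nonneg _) (noiseKernel_nonneg h0 h1 x y)
  rw [hexp] at hnn
  simp only [hfv, hvv, mul_ite, mul_zero, sum_ite_eq, mem_univ, if_true] at hnn
  have e3 : ∑ i, c i * -((1 - ρ ^ 2) * c i) = -((1 - ρ ^ 2) * ∑ i, c i ^ 2) := by
    rw [mul_sum, ← sum_neg_distrib]
    exact sum_congr rfl fun i _ => by ring
  have e4 : ∑ i, c i * c i * (1 - ρ ^ 2) = (1 - ρ ^ 2) * ∑ i, c i ^ 2 := by
    rw [mul_sum]
    exact sum_congr rfl fun i _ => by ring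
  rw [e3, e4] at hnn
  linarith

/-! ### The variance of the noise of a nonnegative function -/

/-- The variance of `T_ρ h`, with `t = ρ²`, in terms of Fourier coefficients. -/
noncomputable def noiseVar {n : ℕ} (t : ℝ) (h : Cube n → ℝ) : ℝ :=
  ∑ S ∈ univ.erase ∅, t ^ S.card * fourierCoeff h S ^ 2

lemma noiseVar_nonneg {n : ℕ} {t : ℝ} (ht : 0 ≤ t) (h : Cube n → ℝ) : 0 ≤ noiseVar t h :=
  sum_nonneg fun S _ => by positivity

/-- Meant for `p` with `2(m+1)`-norm at most `b`, so that the last term has mean at most `b² / 4`.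
Values `|p| ≤ s b` give the first term; larger ones are dominated by `|p|^(m+1) / (s b)^m` and split
by AM–GM. -/
lemma mul_abs_le_young {h p b s : ℝ} {m : ℕ} (hh : 0 ≤ h) (hb : 0 < b) (hs : 0 < s) :
    h * |p| ≤ s * b * h + (s ^ (2 * m))⁻¹ * h ^ 2 +
      b ^ 2 / 4 * (p ^ (2 * (m + 1)) / (b ^ 2) ^ (m + 1)) := by
  have hsb : 0 < s * b := mul_pos hs hb
  have h1 : |p| ≤ s * b + |p| ^ (m + 1) / (s * b) ^ m := by
    rcases le_total |p| (s * b) with h | h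
    · have : 0 ≤ |p| ^ (m + 1) / (s * b) ^ m := by positivity
      linarith
    · have : |p| ≤ |p| ^ (m + 1) / (s * b) ^ m := by
        rw [le_div_iff₀ (by positivity), pow_succ']
        gcongr
      linarith
  have h2 : h * (|p| ^ (m + 1) / (s * b) ^ m) ≤ (s ^ (2 * m))⁻¹ * h ^ 2 +
      b ^ 2 / 4 * (p ^ (2 * (m + 1)) / (b ^ 2) ^ (m + 1)) := by
    have e1 : p ^ (2 * (m + 1)) = (|p| ^ (m + 1)) ^ 2 := by
      rw [pow_mul, ← sq_abs, ← pow_mul, ← pow_mul, mul_comm]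
    have e2 : b ^ 2 / 4 * (p ^ (2 * (m + 1)) / (b ^ 2) ^ (m + 1)) =
        (|p| ^ (m + 1) / (2 * b ^ m)) ^ 2 := by
      rw [e1]
      field_simp
      ring
    have e3 : h * (|p| ^ (m + 1) / (s * b) ^ m) =
        2 * ((s ^ m)⁻¹ * h) * (|p| ^ (m + 1) / (2 * b ^ m)) := by
      rw [mul_pow]
      field_simp
    have e4 : (s ^ (2 * m))⁻¹ * h ^ 2 = ((s ^ m)⁻¹ * h) ^ 2 := by
      rw [mul_pow, inv_pow, ← pow_mul, mul_comm m]
    rw [e2, e3, e4]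
    exact two_mul_le_add_sq _ _
  have := mul_le_mul_of_nonneg_left h1 hh
  linarith

/-- For `h ≥ 0`, the variance of `T_ρ h` is controlled by the mean of `h`, up to a small multiple
of the second moment. -/
theorem noiseVar_le {n m : ℕ} {ρ s : ℝ} (hρ : ρ ^ 2 * (2 * m + 1) ≤ 1) (hs : 0 < s)
    {h : Cube n → ℝ} (hh : ∀ x, 0 ≤ h x) :
    noiseVar (ρ ^ 2) h ≤
      2 * s ^ 2 * expect h ^ 2 + 2 * (s ^ (2 * m))⁻¹ * expect (fun x => h x ^ 2) := by
  set V := noiseVar (ρ ^ 2) h with hV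
  have hV0 : 0 ≤ V := noiseVar_nonneg (sq_nonneg ρ) h
  have hE2 : 0 ≤ expect (fun x => h x ^ 2) := expect_nonneg fun x => sq_nonneg _
  rcases hV0.eq_or_lt with h0 | hpos
  · rw [← h0]
    positivity
  set k : Cube n → ℝ := fun x => h x - expect h with hk
  have hk0 : fourierCoeff k ∅ = 0 := by
    rw [fourierCoeff_empty, hk, expect_sub, expect_const, sub_self]
  have hkS : ∀ S, S ≠ ∅ → fourierCoeff k S = fourierCoeff h S := fun S hS => by
    rw [hk, fourierCoeff_sub, fourierCoeff_const _ hS, sub_zero]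
  have hr : expect (fun x => noise ρ k x ^ 2) = V := by
    simp only [sq (noise ρ k _)]
    rw [expect_mul_eq_sum, ← add_sum_erase univ _ (mem_univ ∅), fourierCoeff_noise, hk0, hV,
      noiseVar]
    simp only [mul_zero, zero_add]
    refine sum_congr rfl fun S hS => ?_
    rw [fourierCoeff_noise, hkS S (ne_of_mem_erase hS), ← pow_mul]
    ring
  -- Self-adjointness writes the variance as a pairing with `h` itself, so that `h ≥ 0` and its mean
  -- can enter. Hypercontractivity then controls the other factor by `√V`.
  have hp : expect (fun x => noise ρ (noise ρ k) x * h x) = V := by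
    rw [expect_noise_mul, ← add_sum_erase univ _ (mem_univ ∅), fourierCoeff_noise, hk0, hV,
      noiseVar]
    simp only [mul_zero, zero_mul, zero_add]
    refine sum_congr rfl fun S hS => ?_
    rw [fourierCoeff_noise, hkS S (ne_of_mem_erase hS), ← pow_mul]
    ring
  have hyp : expect (fun x => noise ρ (noise ρ k) x ^ (2 * (m + 1))) ≤ V ^ (m + 1) := by
    rw [← hr]
    refine expect_noise_pow_le (by omega) ?_ _
    push_cast
    linarith
  have hb : 0 < √V := Real.sqrt_pos.2 hpos
  have hb2 : √V ^ 2 = V := Real.sq_sqrt hV0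
  have hmain : V ≤ s * √V * expect h + (s ^ (2 * m))⁻¹ * expect (fun x => h x ^ 2) + V / 4 := by
    calc V = expect (fun x => noise ρ (noise ρ k) x * h x) := hp.symm
      _ ≤ expect (fun x => s * √V * h x + (s ^ (2 * m))⁻¹ * h x ^ 2 + V / 4 / V ^ (m + 1) *
            noise ρ (noise ρ k) x ^ (2 * (m + 1))) := expect_mono fun x => by
          have h1 := mul_abs_le_young (p := noise ρ (noise ρ k) x) (m := m) (hh x) hb hs
          rw [hb2] at h1
          have h2 : noise ρ (noise ρ k) x * h x ≤ h x * |noise ρ (noise ρ k) x| := by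
            rw [mul_comm]
            exact mul_le_mul_of_nonneg_left (le_abs_self _) (hh x)
          refine h2.trans (h1.trans (le_of_eq ?_))
          ring
      _ = s * √V * expect h + (s ^ (2 * m))⁻¹ * expect (fun x => h x ^ 2) + V / 4 / V ^ (m + 1) *
            expect (fun x => noise ρ (noise ρ k) x ^ (2 * (m + 1))) := by
          rw [expect_add, expect_add, expect_const_mul, expect_const_mul, expect_const_mul]
      _ ≤ s * √V * expect h + (s ^ (2 * m))⁻¹ * expect (fun x => h x ^ 2) + V / 4 / V ^ (m + 1) *
            V ^ (m + 1) := by gcongr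
      _ = _ := by
          rw [div_mul_cancel₀ _ (by positivity)]
  have hyoung : s * √V * expect h ≤ s ^ 2 * expect h ^ 2 + V / 4 := by
    nlinarith [sq_nonneg (s * expect h - √V / 2)]
  linarith

/-- The gradient of an increasing bounded function becomes nearly constant after noise of the
appropriate strength. -/
theorem sum_noiseVar_derivAt_le {n m : ℕ} {t : ℝ} (ht : 0 ≤ t) (htm : t * (2 * m + 1) ≤ 1)
    {f : Cube n → ℝ} (hf : IncreasingBounded f) (hm : Real.exp (-(2 * m)) ≤ funW 1 f f) :
    ∑ i, noiseVar (t / 2) (derivAt i f) ≤ 20 * funW 1 f f := by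
  -- The noise is split in two. The part `σ` makes the second moments summable by Bessel, with total
  -- at most `1/(1-σ²) = 2`; the part `√t` serves hypercontractivity. With threshold `s = e` the
  -- error factor is `e^(-2m) ≤ W_1(f,f)`.
  set σ : ℝ := √(1 / 2) with hσ
  have hσ2 : σ ^ 2 = 1 / 2 := Real.sq_sqrt (by norm_num)
  have hσ0 : 0 ≤ σ := Real.sqrt_nonneg _
  have hσ1 : σ ≤ 1 := Real.sqrt_le_one.2 (by norm_num)
  have ht2 : √t ^ 2 = t := Real.sq_sqrt ht
  have h1 : ∀ i, noiseVar (t / 2) (derivAt i f) ≤ 2 * Real.exp 1 ^ 2 * expect (derivAt i f) ^ 2 +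
      2 * (Real.exp 1 ^ (2 * m))⁻¹ * expect (fun x => noise σ (derivAt i f) x ^ 2) := by
    intro i
    have := noiseVar_le (m := m) (ρ := √t) (by rwa [ht2]) (Real.exp_pos 1)
      (noise_nonneg hσ0 hσ1 (derivAt_nonneg hf.1 i))
    rw [expect_noise, ht2] at this
    refine le_trans (le_of_eq ?_) this
    refine sum_congr rfl fun S _ => ?_
    rw [fourierCoeff_noise, mul_pow (σ ^ _), ← pow_mul, mul_comm S.card, pow_mul, hσ2, ← mul_assoc,
      ← mul_pow]
    congr 2
    ring
  have h2 : ∑ i, expect (fun x => noise σ (derivAt i f) x ^ 2) ≤ 2 := by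
    rw [← expect_sum, ← expect_const (n := n) 2]
    refine expect_mono fun x => ?_
    have := sum_noise_derivAt_sq_le hσ0 hσ1 hf.2 x
    rw [hσ2] at this
    linarith
  have h3 : (Real.exp 1 ^ (2 * m))⁻¹ ≤ funW 1 f f := by
    rw [← Real.exp_nat_mul, ← Real.exp_neg]
    simpa using hm
  have h4 : Real.exp 1 ^ 2 ≤ 8 := by
    have := Real.exp_one_lt_d9
    have := Real.exp_pos 1
    nlinarith
  have h5 : funW 1 f f = ∑ i, expect (derivAt i f) ^ 2 := by
    rw [funW_one_eq]
    exact sum_congr rfl fun i _ => (sq _).symm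
  have h6 : 0 ≤ funW 1 f f := by
    rw [h5]
    positivity
  calc ∑ i, noiseVar (t / 2) (derivAt i f)
      ≤ 2 * Real.exp 1 ^ 2 * funW 1 f f + 2 * (Real.exp 1 ^ (2 * m))⁻¹ *
          ∑ i, expect (fun x => noise σ (derivAt i f) x ^ 2) := by
        rw [h5, mul_sum, mul_sum, ← sum_add_distrib]
        exact sum_le_sum fun i _ => h1 i
    _ ≤ 2 * 8 * funW 1 f f + 2 * funW 1 f f * 2 := by
        gcongr
        exact sum_nonneg fun i _ => expect_nonneg fun x => sq_nonneg _
    _ = 20 * funW 1 f f := by ring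

/-! ### Covariance and noise -/

/-- `E[T_ρ f · g]` as a polynomial in `ρ`. -/
noncomputable def noiseCorr {n : ℕ} (f g : Cube n → ℝ) (ρ : ℝ) : ℝ :=
  ∑ S : Finset (Fin n), ρ ^ S.card * (fourierCoeff f S * fourierCoeff g S)

lemma funCov_eq {n : ℕ} (f g : Cube n → ℝ) : funCov f g = noiseCorr f g 1 - noiseCorr f g 0 := by
  have h0 : noiseCorr f g 0 = expect f * expect g := by
    rw [noiseCorr, sum_eq_single ∅]
    · simp [fourierCoeff_empty]
    · intro S _ hS
      rw [zero_pow (by simpa using hS), zero_mul]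
    · simp
  rw [funCov, h0, expect_mul_eq_sum, noiseCorr]
  simp

/-- Each `S` arises once for every `i ∈ S`, from the mode `S.erase i` of the derivatives. This
produces the factor `S.card` and lowers the exponent by one. -/
lemma sum_expect_noise_derivAt {n : ℕ} (f g : Cube n → ℝ) (ρ : ℝ) :
    ∑ i, expect (fun x => noise ρ (derivAt i f) x * derivAt i g x) =
      ∑ S : Finset (Fin n),
        S.card * ρ ^ (S.card - 1) * (fourierCoeff f S * fourierCoeff g S) := by
  have h : ∀ i : Fin n, expect (fun x => noise ρ (derivAt i f) x * derivAt i g x) =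
      ∑ S : Finset (Fin n), if i ∈ S then
        ρ ^ (S.card - 1) * (fourierCoeff f S * fourierCoeff g S) else 0 := by
    intro i
    have h1 : ∀ S : Finset (Fin n),
        ρ ^ S.card * (fourierCoeff (derivAt i f) S * fourierCoeff (derivAt i g) S) =
        if i ∉ S then ρ ^ S.card * (fourierCoeff f (insert i S) * fourierCoeff g (insert i S))
        else 0 := by
      intro S
      by_cases hi : i ∈ S
      · simp [hi, fourierCoeff_derivAt_of_mem hi]
      · simp [hi, fourierCoeff_derivAt_of_notMem hi]
    rw [expect_noise_mul]
    simp only [h1]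
    rw [← sum_filter, ← sum_filter]
    refine sum_nbij' (fun S => insert i S) (fun S => S.erase i) ?_ ?_ ?_ ?_ ?_
    · intro S _
      simp
    · intro S _
      simp
    · intro S hS
      exact erase_insert (by simpa using hS)
    · intro S hS
      exact insert_erase (by simpa using hS)
    · intro S hS
      rw [card_insert_of_notMem (by simpa using hS), Nat.add_sub_cancel]
  simp only [h]
  rw [sum_comm]
  refine sum_congr rfl fun S _ => ?_
  rw [sum_ite_mem, univ_inter, sum_const, nsmul_eq_mul, mul_assoc]

lemma hasDerivAt_noiseCorr {n : ℕ} (f g : Cube n → ℝ) (ρ : ℝ) :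
    HasDerivAt (noiseCorr f g)
      (∑ i, expect (fun x => noise ρ (derivAt i f) x * derivAt i g x)) ρ := by
  rw [sum_expect_noise_derivAt]
  exact HasDerivAt.fun_sum fun S _ => (hasDerivAt_pow S.card ρ).mul_const _

lemma noiseCorr_sub_ge {n : ℕ} {f g : Cube n → ℝ} {a b C : ℝ} (hab : a ≤ b)
    (h : ∀ ρ, a ≤ ρ → ρ ≤ b →
      C ≤ ∑ i, expect (fun x => noise ρ (derivAt i f) x * derivAt i g x)) :
    C * (b - a) ≤ noiseCorr f g b - noiseCorr f g a := by
  refine (convex_Icc a b).mul_sub_le_image_sub_of_le_deriv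
    (fun ρ _ => (hasDerivAt_noiseCorr f g ρ).continuousAt.continuousWithinAt)
    (fun ρ _ => (hasDerivAt_noiseCorr f g ρ).differentiableAt.differentiableWithinAt)
    (fun ρ hρ => ?_) a (Set.left_mem_Icc.2 hab) b (Set.right_mem_Icc.2 hab) hab
  rw [(hasDerivAt_noiseCorr f g ρ).deriv]
  have := interior_subset hρ
  exact h ρ this.1 this.2

/-- Noise decreases the correlation of increasing functions. -/
theorem noiseCorr_sub_le_funCov {n : ℕ} {f g : Cube n → ℝ} (hf : Monotone f) (hg : Monotone g)
    {R : ℝ} (h0 : 0 ≤ R) (h1 : R ≤ 1) : noiseCorr f g R - noiseCorr f g 0 ≤ funCov f g := by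
  have := noiseCorr_sub_ge (f := f) (g := g) (C := 0) h1 fun ρ hR hρ =>
    sum_nonneg fun i _ => expect_nonneg fun x =>
      mul_nonneg (noise_nonneg (h0.trans hR) hρ (derivAt_nonneg hf i) x) (derivAt_nonneg hg i x)
  rw [funCov_eq]
  linarith

lemma funCov_nonneg {n : ℕ} {f g : Cube n → ℝ} (hf : Monotone f) (hg : Monotone g) :
    0 ≤ funCov f g := by
  simpa using noiseCorr_sub_le_funCov hf hg le_rfl zero_le_one

/-- The mode `∅` contributes exactly `W_1(f,g)`. For the others `ρ^|S| ≤ η (√s √t)^|S|`, because `η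
≤ 1` and `|S| ≥ 1`; Cauchy–Schwarz over all pairs `(i, S)` finishes. -/
lemma funW_one_sub_le {n : ℕ} (f g : Cube n → ℝ) {s t η ρ : ℝ} (hs : 0 ≤ s) (ht : 0 ≤ t)
    (hη0 : 0 ≤ η) (hη1 : η ≤ 1) (hρ0 : 0 ≤ ρ) (hρ : ρ ≤ η * (√s * √t)) :
    funW 1 f g - η * (√(∑ i, noiseVar s (derivAt i f)) * √(∑ i, noiseVar t (derivAt i g))) ≤
      ∑ i, expect (fun x => noise ρ (derivAt i f) x * derivAt i g x) := by
  set a : Fin n × Finset (Fin n) → ℝ := fun p => fourierCoeff (derivAt p.1 f) p.2 with ha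
  set b : Fin n × Finset (Fin n) → ℝ := fun p => fourierCoeff (derivAt p.1 g) p.2 with hb
  set P : Finset (Fin n × Finset (Fin n)) := univ ×ˢ univ.erase ∅ with hP
  have h1 : ∑ i, expect (fun x => noise ρ (derivAt i f) x * derivAt i g x) =
      funW 1 f g + ∑ p ∈ P, ρ ^ p.2.card * (a p * b p) := by
    rw [funW_one_eq, hP, sum_product, ← sum_add_distrib]
    refine sum_congr rfl fun i _ => ?_
    rw [expect_noise_mul, ← add_sum_erase univ _ (mem_univ ∅)]
    simp [fourierCoeff_empty, ha, hb]
  have hvar : ∀ (r : ℝ), 0 ≤ r → ∀ h : Cube n → ℝ, ∑ i, noiseVar r (derivAt i h) =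
      ∑ p ∈ P, (√r ^ p.2.card * |fourierCoeff (derivAt p.1 h) p.2|) ^ 2 := by
    intro r hr h
    rw [hP, sum_product]
    refine sum_congr rfl fun i _ => sum_congr rfl fun S _ => ?_
    rw [mul_pow, sq_abs, ← pow_mul, mul_comm S.card, pow_mul, Real.sq_sqrt hr]
  have hcs := Real.sum_mul_le_sqrt_mul_sqrt P (fun p => √s ^ p.2.card * |a p|)
    (fun p => √t ^ p.2.card * |b p|)
  rw [← hvar s hs, ← hvar t ht] at hcs
  have hterm : ∀ p ∈ P, -(η * (√s ^ p.2.card * |a p| * (√t ^ p.2.card * |b p|))) ≤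
      ρ ^ p.2.card * (a p * b p) := by
    intro p hp
    have hcard : p.2.card ≠ 0 := by
      rw [hP, mem_product, mem_erase] at hp
      simpa using hp.2.1
    have hpow : ρ ^ p.2.card ≤ η * (√s ^ p.2.card * √t ^ p.2.card) := by
      calc ρ ^ p.2.card ≤ (η * (√s * √t)) ^ p.2.card := by gcongr
        _ = η ^ p.2.card * (√s ^ p.2.card * √t ^ p.2.card) := by rw [mul_pow, mul_pow]
        _ ≤ _ := by
            gcongr
            exact pow_le_of_le_one hη0 hη1 hcard
    have h2 : ρ ^ p.2.card * (|a p| * |b p|) ≤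
        η * (√s ^ p.2.card * √t ^ p.2.card) * (|a p| * |b p|) := by gcongr
    have h3 : -(ρ ^ p.2.card * (|a p| * |b p|)) ≤ ρ ^ p.2.card * (a p * b p) := by
      rw [← mul_neg, ← abs_mul]
      gcongr
      exact neg_abs_le _
    linarith
  have hsum := sum_le_sum hterm
  rw [sum_neg_distrib, ← mul_sum] at hsum
  have := mul_le_mul_of_nonneg_left hcs hη0
  rw [h1]
  linarith

lemma funW_one_self_le_one {n : ℕ} {f : Cube n → ℝ} (hf : ∀ x, f x ∈ Set.Icc (-1 : ℝ) 1) :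
    funW 1 f f ≤ 1 := by
  -- At `ρ = 0` the noise operator is the expectation, so any base point will do.
  have h := sum_noise_derivAt_sq_le le_rfl zero_le_one hf (fun _ => false)
  simpa [noise, noiseKernel, funW_one_eq, sq] using h

lemma funW_one_self_nonneg {n : ℕ} (f : Cube n → ℝ) : 0 ≤ funW 1 f f := by
  rw [funW_one_eq]
  exact sum_nonneg fun i _ => mul_self_nonneg _

lemma funW_one_nonneg {n : ℕ} {f g : Cube n → ℝ} (hf : Monotone f) (hg : Monotone g) :
    0 ≤ funW 1 f g := by
  rw [funW_one_eq]
  exact sum_nonneg fun i _ => mul_nonneg (expect_nonneg (derivAt_nonneg hf i))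
    (expect_nonneg (derivAt_nonneg hg i))

/-- The least `m` with `e^(-2m) ≤ u` is about `log(1/u)/2`, and `s = 1/(2(2m+1))` is then
admissible; `4m + 2 ≤ 6 - 2 log u ≤ 6 log(e/u)`. -/
lemma exists_noise_strength {n : ℕ} {f : Cube n → ℝ} (hf : IncreasingBounded f)
    (hu : 0 < funW 1 f f) : ∃ s : ℝ, 0 ≤ s ∧ s ≤ 1 ∧
      1 / (6 * Real.log (Real.exp 1 / funW 1 f f)) ≤ s ∧
      ∑ i, noiseVar s (derivAt i f) ≤ 20 * funW 1 f f := by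
  set u := funW 1 f f with hu_def
  have hu1 : u ≤ 1 := funW_one_self_le_one hf.2
  have hlog : Real.log u ≤ 0 := Real.log_nonpos hu.le hu1
  have hL : Real.log (Real.exp 1 / u) = 1 - Real.log u := by
    rw [Real.log_div (Real.exp_pos 1).ne' hu.ne', Real.log_exp]
  set m := ⌈-Real.log u / 2⌉₊ with hm_def
  have hm1 : -Real.log u / 2 ≤ m := Nat.le_ceil _
  have hm2 : (m : ℝ) < -Real.log u / 2 + 1 := Nat.ceil_lt_add_one (by linarith)
  have hm0 : (0 : ℝ) ≤ m := Nat.cast_nonneg m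
  have hpos : (0 : ℝ) < 2 * m + 1 := by linarith
  refine ⟨1 / (2 * m + 1) / 2, by positivity, ?_, ?_, ?_⟩
  · rw [div_div, div_le_one (by positivity)]
    linarith
  · rw [hL, div_div]
    refine one_div_le_one_div_of_le (by positivity) ?_
    linarith
  · refine sum_noiseVar_derivAt_le (m := m) (by positivity) ?_ hf ?_
    · rw [div_mul_cancel₀ _ hpos.ne']
    · rw [← hu_def, ← Real.le_log_iff_exp_le hu]
      linarith

lemma corrBound_nonneg {w u v : ℝ} (hw : 0 ≤ w) : 0 ≤ corrBound w u v := by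
  unfold corrBound
  positivity

/-- The correlation inequality for increasing functions whose level-one vectors have an angle
bounded away from a right angle. -/
theorem exists_corrBound_le_funCov {K : ℝ} (hK : 0 < K) : ∃ c : ℝ, 0 < c ∧ ∀ (n : ℕ)
    (f g : Cube n → ℝ), IncreasingBounded f → IncreasingBounded g →
      funW 1 f f * funW 1 g g ≤ K * funW 1 f g ^ 2 →
      c * corrBound (funW 1 f g) (funW 1 f f) (funW 1 g g) ≤ funCov f g := by
  -- The deviation from `w` will be at most `20 η √K w`, and this choice makes it at most `w / 2`.
  set η : ℝ := min 1 (1 / (40 * √K)) with hη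
  have hsK : 0 < √K := Real.sqrt_pos.2 hK
  have hη0 : 0 < η := lt_min one_pos (by positivity)
  have hη1 : η ≤ 1 := min_le_left _ _
  have hηK : η * (40 * √K) ≤ 1 := by
    rw [← le_div_iff₀ (by positivity)]
    exact min_le_right _ _
  refine ⟨η / 12, by positivity, fun n f g hf hg hang => ?_⟩
  have hcov := funCov_nonneg hf.1 hg.1
  -- If a weight vanishes, `log (e / 0) = log 0 = 0` in Lean, so `corrBound` is `0` and
  -- nonnegativity of the covariance suffices.
  rcases (funW_one_self_nonneg f).eq_or_lt with hu | hu
  · simpa [corrBound, ← hu] using hcov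
  rcases (funW_one_self_nonneg g).eq_or_lt with hv | hv
  · simpa [corrBound, ← hv] using hcov
  have hw := funW_one_nonneg hf.1 hg.1
  obtain ⟨s, hs0, hs1, hsL, hsV⟩ := exists_noise_strength hf hu
  obtain ⟨t, ht0, ht1, htL, htV⟩ := exists_noise_strength hg hv
  have hLu : 0 < Real.log (Real.exp 1 / funW 1 f f) := by
    rw [Real.log_div (Real.exp_pos 1).ne' hu.ne', Real.log_exp]
    linarith [Real.log_nonpos hu.le (funW_one_self_le_one hf.2)]
  have hLv : 0 < Real.log (Real.exp 1 / funW 1 g g) := by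
    rw [Real.log_div (Real.exp_pos 1).ne' hv.ne', Real.log_exp]
    linarith [Real.log_nonpos hv.le (funW_one_self_le_one hg.2)]
  set u := funW 1 f f
  set v := funW 1 g g
  set w := funW 1 f g
  set Lu := Real.log (Real.exp 1 / u)
  set Lv := Real.log (Real.exp 1 / v)
  have hss : √s ≤ 1 := Real.sqrt_le_one.2 hs1
  have htt : √t ≤ 1 := Real.sqrt_le_one.2 ht1
  have herr : √(∑ i, noiseVar s (derivAt i f)) * √(∑ i, noiseVar t (derivAt i g)) ≤
      20 * (√K * w) := by
    calc √(∑ i, noiseVar s (derivAt i f)) * √(∑ i, noiseVar t (derivAt i g))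
        ≤ √(20 * u) * √(20 * v) := by gcongr
      _ = √(20 ^ 2 * (u * v)) := by
          rw [← Real.sqrt_mul (by positivity)]
          congr 1
          ring
      _ ≤ √(20 ^ 2 * (K * w ^ 2)) := by gcongr
      _ = 20 * (√K * w) := by
          rw [Real.sqrt_mul (by norm_num), Real.sqrt_sq (by norm_num), Real.sqrt_mul hK.le,
            Real.sqrt_sq hw]
  have herr2 : η * (20 * (√K * w)) ≤ w / 2 := by
    have := mul_le_mul_of_nonneg_right hηK hw
    linarith
  set R := η * (√s * √t) with hR
  have hR0 : 0 ≤ R := by positivity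
  have hR1 : R ≤ 1 := mul_le_one₀ hη1 (by positivity) (mul_le_one₀ hss (by positivity) htt)
  have hgrad : w / 2 * (R - 0) ≤ noiseCorr f g R - noiseCorr f g 0 :=
    noiseCorr_sub_ge hR0 fun ρ h0 h1 => by
      have h2 := funW_one_sub_le f g hs0 ht0 hη0.le hη1 h0 h1
      have h3 := mul_le_mul_of_nonneg_left herr hη0.le
      linarith
  have hRlow : η * (1 / (6 * (√Lu * √Lv))) ≤ R := by
    rw [hR]
    gcongr
    calc 1 / (6 * (√Lu * √Lv)) = √(1 / (6 * Lu)) * √(1 / (6 * Lv)) := by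
          rw [← Real.sqrt_mul hLu.le, ← Real.sqrt_mul (by positivity : 0 ≤ 1 / (6 * Lu)),
            show 1 / (6 * Lu) * (1 / (6 * Lv)) = (1 / 6) ^ 2 / (Lu * Lv) by
              field_simp,
            Real.sqrt_div (by norm_num), Real.sqrt_sq (by norm_num)]
          field_simp
      _ ≤ √s * √t := by gcongr
  calc η / 12 * corrBound w u v = w / 2 * (η * (1 / (6 * (√Lu * √Lv)))) := by
        rw [show corrBound w u v = w / (√Lu * √Lv) from rfl]
        field_simp
        ring
    _ ≤ w / 2 * R := by gcongr
    _ ≤ funCov f g := by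
        have := noiseCorr_sub_le_funCov hf.1 hg.1 hR0 hR1
        linarith

/-- A reverse Cauchy–Schwarz inequality: multiply the hypothesis by `a i * b j` and sum over `i` and
`j`. -/
lemma WeaklyEqualRatios.sum_mul_sum_le {n : ℕ} {K : ℝ} {a b : Fin n → ℝ} (ha : ∀ i, 0 ≤ a i)
    (hb : ∀ i, 0 ≤ b i) (h : WeaklyEqualRatios K a b) :
    (∑ i, a i * a i) * (∑ i, b i * b i) ≤ K * (∑ i, a i * b i) ^ 2 := by
  rw [sq, sum_mul_sum, sum_mul_sum, mul_sum]
  refine sum_le_sum fun i _ => ?_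
  rw [mul_sum]
  refine sum_le_sum fun j _ => ?_
  have := mul_le_mul_of_nonneg_right (h i j) (mul_nonneg (ha i) (hb j))
  linarith

lemma EqualRatios.weaklyEqualRatios {n : ℕ} {a b : Fin n → ℝ} (h : EqualRatios a b) :
    WeaklyEqualRatios 1 a b := fun i j => by rw [h i j, one_mul]

lemma equalRatios_of_const {n : ℕ} {a b : Fin n → ℝ} (ha : ∀ i j, a i = a j)
    (hb : ∀ i j, b i = b j) : EqualRatios a b := fun i j => by rw [ha i j, hb i j]

lemma FunWeaklySimilar.funW_mul_le {n : ℕ} {K : ℝ} {f g : Cube n → ℝ} (hf : Monotone f)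
    (hg : Monotone g) (h : FunWeaklySimilar K f g) :
    funW 1 f f * funW 1 g g ≤ K * funW 1 f g ^ 2 := by
  simp only [funW_one_eq]
  refine WeaklyEqualRatios.sum_mul_sum_le (fun i => expect_nonneg (derivAt_nonneg hf i))
    (fun i => expect_nonneg (derivAt_nonneg hg i)) fun i j => ?_
  have := h i j
  simp only [funInfluence_eq hf, funInfluence_eq hg] at this
  linarith

/-! ### Families -/

open Classical in
/-- The function that is `1` on `A` and `-1` outside `A`. -/
noncomputable def signFun {n : ℕ} (A : Set (Cube n)) (x : Cube n) : ℝ := if x ∈ A then 1 else -1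

open Classical in
lemma mu_eq_expect {n : ℕ} (A : Set (Cube n)) : mu A = expect (fun x => if x ∈ A then 1 else 0) := by
  rw [mu, expect, Set.ncard_eq_toFinset_card', sum_boole]
  congr 2
  congr 1
  ext x
  simp

lemma increasingBounded_signFun {n : ℕ} {A : Set (Cube n)} (hA : IsUpperSet A) :
    IncreasingBounded (signFun A) := by
  refine ⟨fun x y hxy => ?_, fun x => ?_⟩
  · unfold signFun
    by_cases hx : x ∈ A
    · simp [hx, hA hxy hx]
    · split_ifs <;> norm_num
  · unfold signFun
    split_ifs <;> norm_num

/-- `signFun A` is twice the indicator minus one. The covariance picks up a factor `4`, whereas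
`W_1` is unchanged because `D_i` already halves the increment. -/
lemma funCov_signFun {n : ℕ} (A B : Set (Cube n)) :
    funCov (signFun A) (signFun B) = 4 * famCov A B := by
  classical
  have h1 : ∀ A : Set (Cube n), expect (signFun A) = 2 * mu A - 1 := by
    intro A
    rw [mu_eq_expect, ← expect_const_mul, ← expect_const (n := n) 1, ← expect_sub]
    congr 1
    ext x
    unfold signFun
    split_ifs <;> norm_num
  have h2 : expect (fun x => signFun A x * signFun B x) =
      4 * mu (A ∩ B) - 2 * mu A - 2 * mu B + 1 := by
    rw [mu_eq_expect, mu_eq_expect, mu_eq_expect, ← expect_const_mul, ← expect_const_mul,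
      ← expect_const_mul, ← expect_const (n := n) 1, ← expect_sub, ← expect_sub, ← expect_add]
    congr 1
    ext x
    unfold signFun
    by_cases hA : x ∈ A <;> by_cases hB : x ∈ B <;> simp [hA, hB] <;> norm_num
  rw [funCov, h1, h1, h2, famCov]
  ring

lemma funInfluence_signFun {n : ℕ} (A : Set (Cube n)) (i : Fin n) :
    funInfluence (signFun A) i = 2 * famInfluence A i := by
  classical
  have h := expect_flipAt i (fun x => if x ∈ A ∧ flipAt i x ∉ A then (1 : ℝ) else 0)
  have h1 : (fun x => |signFun A x - signFun A (flipAt i x)|) = fun x =>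
      2 * (if x ∈ A ∧ flipAt i x ∉ A then (1 : ℝ) else 0) +
        2 * (if flipAt i x ∈ A ∧ flipAt i (flipAt i x) ∉ A then (1 : ℝ) else 0) := by
    ext x
    rw [flipAt_flipAt]
    unfold signFun
    by_cases hA : x ∈ A <;> by_cases hB : flipAt i x ∈ A <;> simp [hA, hB] <;> norm_num
  rw [funInfluence, h1, expect_add, expect_const_mul, expect_const_mul, h, famInfluence,
    mu_eq_expect]
  simp only [Set.mem_ofPred_eq]
  ring_nf

lemma famInfluence_eq {n : ℕ} {A : Set (Cube n)} (hA : IsUpperSet A) (i : Fin n) :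
    famInfluence A i = expect (derivAt i (signFun A)) := by
  have h1 := funInfluence_signFun A i
  rw [funInfluence_eq (increasingBounded_signFun hA).1] at h1
  linarith

lemma funW_one_signFun {n : ℕ} {A B : Set (Cube n)} (hA : IsUpperSet A) (hB : IsUpperSet B) :
    funW 1 (signFun A) (signFun B) = famW1 A B := by
  simp only [funW_one_eq, famW1, famInfluence_eq hA, famInfluence_eq hB]

lemma famW1_nonneg {n : ℕ} {A B : Set (Cube n)} (hA : IsUpperSet A) (hB : IsUpperSet B) :
    0 ≤ famW1 A B := by
  rw [← funW_one_signFun hA hB]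
  exact funW_one_nonneg (increasingBounded_signFun hA).1 (increasingBounded_signFun hB).1

lemma FamWeaklySimilar.signFun {n : ℕ} {K : ℝ} {A B : Set (Cube n)}
    (h : FamWeaklySimilar K A B) : FunWeaklySimilar K (signFun A) (signFun B) := fun i j => by
  have := h i j
  simp only [funInfluence_signFun]
  linarith

/-- The correlation inequality for weakly similar increasing families and functions. -/
theorem exists_corrBound_le_of_weaklySimilar {K : ℝ} (hK : 0 < K) : ∃ c : ℝ, 0 < c ∧ ∀ n : ℕ,
    (∀ A B : Set (Cube n), IsUpperSet A → IsUpperSet B → FamWeaklySimilar K A B →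
      famCov A B ≥ c * corrBound (famW1 A B) (famW1 A A) (famW1 B B)) ∧
    (∀ f g : Cube n → ℝ, IncreasingBounded f → IncreasingBounded g → FunWeaklySimilar K f g →
      funCov f g ≥ c * corrBound (funW 1 f g) (funW 1 f f) (funW 1 g g)) := by
  obtain ⟨c, hc, h⟩ := exists_corrBound_le_funCov hK
  refine ⟨c / 4, by positivity, fun n => ⟨fun A B hA hB hAB => ?_, fun f g hf hg hfg => ?_⟩⟩
  · have hfA := increasingBounded_signFun hA
    have hfB := increasingBounded_signFun hB
    have h1 := h n _ _ hfA hfB (hAB.signFun.funW_mul_le hfA.1 hfB.1)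
    rw [funCov_signFun, funW_one_signFun hA hB, funW_one_signFun hA hA,
      funW_one_signFun hB hB] at h1
    linarith
  · have h1 := h n _ _ hf hg (hfg.funW_mul_le hf.1 hg.1)
    have h2 := mul_nonneg hc.le
      (corrBound_nonneg (u := funW 1 f f) (v := funW 1 g g) (funW_one_nonneg hf.1 hg.1))
    linarith

/-! ### Regular families and functions -/

lemma const_mul_div_total_sq {n : ℕ} (k a : ℝ) (hn : n ≠ 0) :
    k * n / (n * a) ^ 2 = k / (n * a ^ 2) := by
  have hn' : (n : ℝ) ≠ 0 := Nat.cast_ne_zero.2 hn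
  rw [show ((n : ℝ) * a) ^ 2 = n * a ^ 2 * n by ring, mul_div_mul_right _ _ hn']

lemma corrBound_famRegular {n : ℕ} {A B : Set (Cube n)} (hA : FamRegular A) (hB : FamRegular B) :
    corrBound (famW1 A B) (famW1 A A) (famW1 B B) =
      ∑ i, famInfluence A i / √(Real.log (Real.exp 1 / (n * famInfluence A i ^ 2))) *
        (famInfluence B i / √(Real.log (Real.exp 1 / (n * famInfluence B i ^ 2)))) := by
  rcases n.eq_zero_or_pos with rfl | hn
  · simp [corrBound, famW1]
  simp only [corrBound, famW1, hA _ ⟨0, hn⟩, hB _ ⟨0, hn⟩, sum_const, card_univ, Fintype.card_fin,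
    nsmul_eq_mul, ← sq]
  rw [div_mul_div_comm, mul_div_assoc]

lemma corrBound_famRegular_total {n : ℕ} {A B : Set (Cube n)} (hA : FamRegular A)
    (hB : FamRegular B) :
    corrBound (famW1 A B) (famW1 A A) (famW1 B B) =
      famTotalInfluence A * famTotalInfluence B /
        (n * √(Real.log (Real.exp 1 * n / famTotalInfluence A ^ 2)) *
          √(Real.log (Real.exp 1 * n / famTotalInfluence B ^ 2))) := by
  rcases n.eq_zero_or_pos with rfl | hn
  · simp [corrBound, famW1]
  have hn' : (n : ℝ) ≠ 0 := Nat.cast_ne_zero.2 hn.ne'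
  simp only [corrBound, famW1, famTotalInfluence, hA _ ⟨0, hn⟩, hB _ ⟨0, hn⟩, sum_const, card_univ,
    Fintype.card_fin, nsmul_eq_mul, ← sq, const_mul_div_total_sq _ _ hn.ne']
  rw [mul_mul_mul_comm, mul_assoc (n : ℝ) (n : ℝ), mul_assoc (n : ℝ) (√_), mul_div_mul_left _ _ hn']

/-- Each `E[D_i f]` is half an influence. This accounts for both the outer factor `4` and the `4`
inside the logarithms. -/
lemma corrBound_funRegular {n : ℕ} {f g : Cube n → ℝ} (hf : Monotone f) (hg : Monotone g)
    (hf' : FunRegular f) (hg' : FunRegular g) :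
    4 * corrBound (funW 1 f g) (funW 1 f f) (funW 1 g g) =
      funTotalInfluence f * funTotalInfluence g /
        (n * √(Real.log (4 * Real.exp 1 * n / funTotalInfluence f ^ 2)) *
          √(Real.log (4 * Real.exp 1 * n / funTotalInfluence g ^ 2))) := by
  rcases n.eq_zero_or_pos with rfl | hn
  · simp [corrBound, funW_one_eq]
  have hn' : (n : ℝ) ≠ 0 := Nat.cast_ne_zero.2 hn.ne'
  have hd : ∀ {h : Cube n → ℝ}, Monotone h → FunRegular h → ∀ i,
      expect (derivAt i h) = funInfluence h ⟨0, hn⟩ / 2 := fun hh hh' i => by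
    rw [← hh' i, funInfluence_eq hh]
    ring
  have he : ∀ a : ℝ, 4 * Real.exp 1 / (n * a ^ 2) = Real.exp 1 / (n * (a / 2 * (a / 2))) := by
    intro a
    rw [show (n : ℝ) * a ^ 2 = 4 * (n * (a / 2 * (a / 2))) by ring,
      mul_div_mul_left _ _ four_ne_zero]
  simp only [corrBound, funW_one_eq, funTotalInfluence, hd hf hf', hd hg hg', hf' _ ⟨0, hn⟩,
    hg' _ ⟨0, hn⟩, sum_const, card_univ, Fintype.card_fin, nsmul_eq_mul,
    const_mul_div_total_sq _ _ hn.ne', he]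
  rw [mul_mul_mul_comm, mul_assoc (n : ℝ) (n : ℝ), mul_assoc (n : ℝ) (√_), mul_div_mul_left _ _ hn']
  ring

end CubeCorrelation

open CubeCorrelation

theorem mainTheorem1 :
    -- similar and regular pairs, with one universal constant
    (∃ c : ℝ, 0 < c ∧ ∀ n : ℕ,
      (∀ A B : Set (Cube n), IsUpperSet A → IsUpperSet B → FamSimilar A B →
        famCov A B ≥ c * corrBound (famW1 A B) (famW1 A A) (famW1 B B)) ∧
      (∀ A B : Set (Cube n), IsUpperSet A → IsUpperSet B → FamRegular A → FamRegular B →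
        famCov A B ≥
            c * ∑ i, famInfluence A i / √(Real.log (Real.exp 1 / (n * famInfluence A i ^ 2))) *
              (famInfluence B i / √(Real.log (Real.exp 1 / (n * famInfluence B i ^ 2)))) ∧
        c * ∑ i, famInfluence A i / √(Real.log (Real.exp 1 / (n * famInfluence A i ^ 2))) *
              (famInfluence B i / √(Real.log (Real.exp 1 / (n * famInfluence B i ^ 2)))) =
          c * (famTotalInfluence A * famTotalInfluence B /
            (n * √(Real.log (Real.exp 1 * n / famTotalInfluence A ^ 2)) *
              √(Real.log (Real.exp 1 * n / famTotalInfluence B ^ 2))))) ∧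
      (∀ f g : Cube n → ℝ, IncreasingBounded f → IncreasingBounded g → FunSimilar f g →
        funCov f g ≥ c * corrBound (funW 1 f g) (funW 1 f f) (funW 1 g g)) ∧
      (∀ f g : Cube n → ℝ, IncreasingBounded f → IncreasingBounded g →
        FunRegular f → FunRegular g →
        funCov f g ≥ c * (funTotalInfluence f * funTotalInfluence g /
            (n * √(Real.log (4 * Real.exp 1 * n / funTotalInfluence f ^ 2)) *
              √(Real.log (4 * Real.exp 1 * n / funTotalInfluence g ^ 2)))))) ∧
    -- weakly similar pairs, with a constant that depends only on the similarity constant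
    (∀ K : ℝ, 0 < K → ∃ c : ℝ, 0 < c ∧ ∀ n : ℕ,
      (∀ A B : Set (Cube n), IsUpperSet A → IsUpperSet B → FamWeaklySimilar K A B →
        famCov A B ≥ c * corrBound (famW1 A B) (famW1 A A) (famW1 B B)) ∧
      (∀ f g : Cube n → ℝ, IncreasingBounded f → IncreasingBounded g → FunWeaklySimilar K f g →
        funCov f g ≥ c * corrBound (funW 1 f g) (funW 1 f f) (funW 1 g g))) := by
  obtain ⟨c, hc, h⟩ := exists_corrBound_le_of_weaklySimilar one_pos
  -- The constant `c / 4` is forced by regular functions, whose bound equals `4 * corrBound`; the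
  -- other clauses are weakened to match.
  have hle : ∀ {X Y : ℝ}, 0 ≤ X → Y ≥ c * X → Y ≥ c / 4 * X := fun hX hY => by
    have := mul_nonneg hc.le hX
    linarith
  have hfam : ∀ (n : ℕ) (A B : Set (Cube n)), IsUpperSet A → IsUpperSet B → FamSimilar A B →
      famCov A B ≥ c / 4 * corrBound (famW1 A B) (famW1 A A) (famW1 B B) :=
    fun n A B hA hB hAB => hle (corrBound_nonneg (famW1_nonneg hA hB))
      ((h n).1 A B hA hB hAB.weaklyEqualRatios)
  refine ⟨⟨c / 4, by positivity, fun n => ⟨hfam n, fun A B hA hB hA' hB' => ⟨?_, ?_⟩,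
    fun f g hf hg hfg => hle (corrBound_nonneg (funW_one_nonneg hf.1 hg.1))
      ((h n).2 f g hf hg hfg.weaklyEqualRatios),
    fun f g hf hg hf' hg' => ?_⟩⟩, fun K hK => exists_corrBound_le_of_weaklySimilar hK⟩
  · rw [← corrBound_famRegular hA' hB']
    exact hfam n A B hA hB (equalRatios_of_const hA' hB')
  · rw [← corrBound_famRegular hA' hB', corrBound_famRegular_total hA' hB']
  · have := (h n).2 f g hf hg (equalRatios_of_const hf' hg').weaklyEqualRatios
    rw [← corrBound_funRegular hf.1 hg.1 hf' hg']
    linarith
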